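/- Let $A\in\mathbb{Q}^{N\times N}$ and $P_1,\dots,P_m\in\mathbb{Q}[x_1,\dots,x_N]$, and consider the loop $$\mathtt{P_1}:\quad \textbf{while } (P_1(X)>0\wedge\dots\wedge P_m(X)>0)\ \{X:=AX\},$$ which is called terminating if for every $X\in\mathbb{R}^N$ there is $n\ge 0$ such that $P_i(A^nX)\le 0$ for some $i$. *Expansion.* Let $s$ be the multiplicity of $0$ as a root of the characteristic polynomial of $A$. Substituting the general expression of $A^{n+s}X$ (a finite sum of terms $p(X,n)\,\xi^n$, with $p$ polynomial and $\xi\neq 0$) for $X$ in $P_i$ gives $$P_i(X,n)=\sum_{\eta} p_{i\eta}(X,n)\,\eta^n ,\qquad n\ge 0,$$ a finite sum over distinct nonzero complex numbers $\eta=|\eta|e^{2\pi\mathbf{i}\alpha_\eta}$, with nonzero $p_{i\eta}\in\mathbb{C}[X][n]$. For each $i$ choose an integer $T_i\ge 1$ with $T_i\alpha_\eta\in\mathbb{Z}$ for all $\eta$ with $\alpha_\eta$ rational, and for each modulus $r$ real numbers $\theta_1,\dots,\theta_d$ (depending on $i$ and $r$) that are rationally independent (no nontrivial rational combination is rational), together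 with integers $b_{\eta,1},\dots,b_{\eta,d}$ such that $T_i\bigl(\alpha_\eta-\sum_q b_{\eta,q}\theta_q\bigr)\in\mathbb{Z}$ for every $\eta$ with $|\eta|=r$ and $\alpha_\eta$ irrational. For $1\le i\le m$ and $0\le t<T_i$ put $G_{i,t}(X,n)=P_i(X,T_in+t)$ and collect $$G_{i,t}(X,n)=\sum_{(r,l)} C_{i,t,r,l}(X,n)\,n^l r^{T_in+t},\qquad C_{i,t,r,l}(X,n)=C^0(X)+C^1(X)+C^2(X,n),$$ where $r$ runs over the moduli $|\eta|$, $l$ runs from $0$ to the largest degree in $n$ of the $p_{i\eta}$ with $|\eta|=r$, and $C^0,C^1,C^2$ collect the contributions of the $\eta$ with $\alpha_\eta\in\mathbb{Z}$, with $\alpha_\eta\in\mathbb{Q}\setminus\mathbb{Z}$, and with $\alpha_\eta$ irrational. All three are real, and $C^2(X,n)=C^2\bigl(X;e^{2\pi\mathbf{i}(T_in+t)\theta_1},\dots,e^{2\pi\mathbf{i}(T_in+t)\theta_d}\bigr)$ for the function $C^2(X;y)$ on the torus $\{y\in\mathbb{C}^d:|y_1|=\dots=|y_d|=1\}$ obtained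 by replacing each $e^{2\pi\mathbf{i}(T_in+t)\alpha_\eta}$ by $e^{2\pi\mathbf{i}t(\alpha_\eta-\sum_q b_{\eta,q}\theta_q)}\prod_q y_q^{b_{\eta,q}}$. Let $\mu_{i,t,r,l}(X)=\min_{y}\bigl(C^0(X)+C^1(X)+C^2(X;y)\bigr)$ over this torus, and write $C_{i,t,r,l}\succ0$ (resp. $\succeq0$) at $X$ if $\mu_{i,t,r,l}(X)>0$ (resp. $\ge0$). *Algorithm* $\mathtt{Termination}$. A guess selects for every $(i,t)$ one of the terms $(r_{i,t},l_{i,t})$ of $G_{i,t}$. Its system requires of $X\in\mathbb{R}^N$, for every $(i,t)$, that $C_{i,t,r_{i,t},l_{i,t}}\succ 0$ and that $C_{i,t,r,l}\succeq 0$ for all terms $(r,l)$ of $G_{i,t}$ with $r>r_{i,t}$, or $r=r_{i,t}$ and $l>l_{i,t}$. The algorithm returns "nonterminating" if the system of at least one guess has a solution $X\in\mathbb{R}^N$, and "terminating" otherwise. *Assumption.* For every $X\in\mathbb{R}^N$ and every $(i,t,r,l)$: if $C^2_{i,t,r,l}(X,n)$ is not zero for all $n\in\mathbb{N}$, then $\mu_{i,t,r,l}(X)\neq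 0$. **Theorem.** Choices of the $T_i$, the $\theta$'s and the $b$'s as above always exist, and for all such choices: (1) under the Assumption, $\mathtt{Termination}$ returns "terminating" if and only if the loop $\mathtt{P_1}$ is terminating; (2) without the Assumption, if $\mathtt{Termination}$ returns "nonterminating", then $\mathtt{P_1}$ is not terminating. -/

import Mathlib

namespace LinearLoop

noncomputable section

/-! ### The loop `while (P₁(X) > 0 ∧ … ∧ Pₘ(X) > 0) { X := A X }` -/

/-- One execution of the loop body on a real state. -/
def step {N : ℕ} (A : Matrix (Fin N) (Fin N) ℚ) (X : Fin N → ℝ) : Fin N → ℝ :=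
  (A.map (Rat.cast : ℚ → ℝ)).mulVec X

/-- The loop guard: all the polynomials are positive at the state `X`. -/
def Guard {N m : ℕ} (P : Fin m → MvPolynomial (Fin N) ℚ) (X : Fin N → ℝ) : Prop :=
  ∀ i, 0 < MvPolynomial.aeval X (P i)

/-- The loop terminates on the input `X`: after finitely many executions of the body
the guard fails. -/
def TerminatesOn {N m : ℕ} (A : Matrix (Fin N) (Fin N) ℚ)
    (P : Fin m → MvPolynomial (Fin N) ℚ) (X : Fin N → ℝ) : Prop :=
  ∃ n : ℕ, ¬ Guard P ((step A)^[n] X)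

/-- The loop is terminating (over `ℝ`): it terminates on every real input. -/
def Terminating {N m : ℕ} (A : Matrix (Fin N) (Fin N) ℚ)
    (P : Fin m → MvPolynomial (Fin N) ℚ) : Prop :=
  ∀ X : Fin N → ℝ, TerminatesOn A P X

/-! ### Exponential polynomials `∑ p_η(X, n) η ^ n` -/

/-- Formal expressions `∑_η p_η(X, n) η ^ n`, a finite sum over nonzero complex numbers `η`, where
`p_η` is a polynomial in `n` whose coefficients are complex polynomials in the symbolic input
`X = (X₁, …, X_N)`.  The product of the monoid algebra is `η ^ n * η' ^ n = (η η') ^ n`. -/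
abbrev ExpPoly (N : ℕ) : Type :=
  MonoidAlgebra (Polynomial (MvPolynomial (Fin N) ℂ)) ℂˣ

/-- The value of `∑ p_η(X, n) η ^ n` at a real input `X` and `n : ℕ`. -/
def evalAt {N : ℕ} (X : Fin N → ℝ) (n : ℕ) : ExpPoly N →+* ℂ :=
  MonoidAlgebra.liftNCRingHom
    ((MvPolynomial.eval fun i => (X i : ℂ)).comp
      (Polynomial.evalRingHom (n : MvPolynomial (Fin N) ℂ)))
    ((powMonoidHom n).comp (Units.coeHom ℂ))
    (fun _ _ => Commute.all _ _)

theorem evalAt_single {N : ℕ} (X : Fin N → ℝ) (n : ℕ) (η : ℂˣ)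
    (p : Polynomial (MvPolynomial (Fin N) ℂ)) :
    evalAt X n (MonoidAlgebra.single η p) =
      MvPolynomial.eval (fun i => (X i : ℂ)) (p.eval (n : MvPolynomial (Fin N) ℂ)) *
        (η : ℂ) ^ n := by
  simp [evalAt, MonoidAlgebra.liftNCRingHom]

/-- The multiplicity `s` of `0` as a root of the characteristic polynomial of `A`. -/
def zeroMult {N : ℕ} (A : Matrix (Fin N) (Fin N) ℚ) : ℕ :=
  A.charpoly.rootMultiplicity 0

/-- `f₁, …, f_N` is a general expression of `A ^ (n + s) X`. -/
def IsGeneralExpression {N : ℕ} (A : Matrix (Fin N) (Fin N) ℚ) (f : Fin N → ExpPoly N) : Prop :=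
  ∀ (X : Fin N → ℝ) (n : ℕ) (j : Fin N),
    evalAt X n (f j) = (((step A)^[n + zeroMult A] X j : ℝ) : ℂ)

theorem exists_repr_pow {N : ℕ} (φ : Module.End ℂ (Fin N → ℂ)) (s : ℕ)
    (q : Polynomial ℂ) (hq : q.eval 0 ≠ 0) (hφ : Polynomial.aeval φ (Polynomial.X ^ s * q) = 0)
    (v : Fin N → ℂ) :
    ∃ f : Fin N → ExpPoly N, ∀ (X : Fin N → ℝ) (n : ℕ) (j : Fin N),
      evalAt X n (f j) = (φ ^ (n + s)) v j := by
  have hv : v ∈ ⨆ μ, φ.maxGenEigenspace μ := by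
    rw [Module.End.iSup_maxGenEigenspace_eq_top]; trivial
  induction hv using Submodule.iSup_induction' with
  | zero => exact ⟨0, fun X n j => by simp⟩
  | add x y _ _ hx hy =>
    obtain ⟨f, hf⟩ := hx
    obtain ⟨g, hg⟩ := hy
    exact ⟨f + g, fun X n j => by simp [hf, hg]⟩
  | mem ξ v hv =>
    obtain ⟨k, hk⟩ := (Module.End.mem_maxGenEigenspace _ _ _).1 hv
    by_cases hξ : ξ = 0
    · subst hξ
      simp only [zero_smul, sub_zero] at hk
      have hc : IsCoprime (Polynomial.X ^ k) q := by
        apply IsCoprime.pow_left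
        rw [Polynomial.irreducible_X.coprime_iff_not_dvd, Polynomial.X_dvd_iff,
          Polynomial.coeff_zero_eq_eval_zero]
        exact hq
      obtain ⟨a, b, hab⟩ := hc
      have key : (φ ^ s) v = 0 := by
        have h1 : φ ^ s = Polynomial.aeval φ a * φ ^ s * φ ^ k
            + Polynomial.aeval φ b * Polynomial.aeval φ (Polynomial.X ^ s * q) := by
          have : (Polynomial.X ^ s : Polynomial ℂ) = a * Polynomial.X ^ s * Polynomial.X ^ k
              + b * (Polynomial.X ^ s * q) := by
            linear_combination (-(Polynomial.X ^ s : Polynomial ℂ)) * hab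
          have h2 := congrArg (Polynomial.aeval φ) this
          simpa using h2
        rw [h1, hφ]
        simp [hk]
      refine ⟨0, fun X n j => ?_⟩
      simp [pow_add, key]
    · let R := MvPolynomial (Fin N) ℂ
      let η : ℂˣ := Units.mk0 ξ hξ
      refine ⟨fun j => ∑ l ∈ Finset.range k, MonoidAlgebra.single η
        (Polynomial.C (MvPolynomial.C ((l.factorial : ℂ)⁻¹ * ξ ^ s * (ξ ^ l)⁻¹ *
          ((φ - ξ • 1) ^ l) v j)) *
          (descPochhammer R l).comp (Polynomial.X + Polynomial.C (s : R))), fun X n j => ?_⟩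
      have hz : ∀ l, k ≤ l → ((φ - ξ • 1) ^ l) v = 0 := by
        intro l hl
        obtain ⟨d, rfl⟩ := Nat.exists_eq_add_of_le hl
        rw [add_comm, pow_add]
        simp [hk]
      have h1 : (φ ^ (n + s)) v = ∑ l ∈ Finset.range k,
          (((n + s).choose l : ℂ) * ξ ^ (n + s) * (ξ ^ l)⁻¹) • ((φ - ξ • 1) ^ l) v := by
        have hcomm : Commute (φ - ξ • 1) (ξ • (1 : Module.End ℂ (Fin N → ℂ))) :=
          (Commute.one_right _).smul_right _
        have h2 := hcomm.add_pow (n + s)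
        rw [sub_add_cancel] at h2
        have h3 : (φ ^ (n + s)) v = ∑ l ∈ Finset.range (n + s + 1),
            (((n + s).choose l : ℂ) * ξ ^ (n + s) * (ξ ^ l)⁻¹) • ((φ - ξ • 1) ^ l) v := by
          rw [h2, LinearMap.sum_apply]
          refine Finset.sum_congr rfl fun l hl => ?_
          have hl' : l ≤ n + s := by simpa [Nat.lt_succ_iff] using hl
          have e : ξ ^ (n + s) * (ξ ^ l)⁻¹ = ξ ^ (n + s - l) := by
            rw [pow_sub₀ _ hξ hl']
          rw [mul_assoc ((n + s).choose l : ℂ), e, smul_pow, one_pow, ← nsmul_eq_mul',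
            LinearMap.smul_apply, mul_smul, Nat.cast_smul_eq_nsmul]
          simp
        rw [h3]
        have e1 := Finset.sum_subset (s₁ := Finset.range (n + s + 1))
          (s₂ := Finset.range (n + s + 1 + k))
          (f := fun l => (((n + s).choose l : ℂ) * ξ ^ (n + s) * (ξ ^ l)⁻¹) •
            ((φ - ξ • 1) ^ l) v) (by intro x; simp; omega) (by
              intro x _ hx
              have : n + s < x := by simpa [Nat.lt_succ_iff] using hx
              simp [Nat.choose_eq_zero_of_lt this])
        have e2 := Finset.sum_subset (s₁ := Finset.range k)
          (s₂ := Finset.range (n + s + 1 + k))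
          (f := fun l => (((n + s).choose l : ℂ) * ξ ^ (n + s) * (ξ ^ l)⁻¹) •
            ((φ - ξ • 1) ^ l) v) (by intro x; simp; omega) (by
              intro x _ hx
              have : k ≤ x := by simpa using hx
              simp [hz x this])
        rw [e1, ← e2]
      rw [h1, map_sum, Finset.sum_apply]
      refine Finset.sum_congr rfl fun l _ => ?_
      rw [evalAt_single]
      have hd : Polynomial.eval (n : R) ((descPochhammer R l).comp
          (Polynomial.X + Polynomial.C (s : R))) = ((n + s).descFactorial l : R) := by
        rw [Polynomial.eval_comp]
        have := descPochhammer_eval_eq_descFactorial R (n + s) l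
        simpa using this
      have hf : (l.factorial : ℂ) ≠ 0 := by exact_mod_cast l.factorial_ne_zero
      have hch : ((n + s).choose l : ℂ) = (l.factorial : ℂ)⁻¹ * ((n + s).descFactorial l : ℂ) := by
        rw [Nat.descFactorial_eq_factorial_mul_choose]
        push_cast
        field_simp
      rw [Polynomial.eval_mul, hd, hch, Polynomial.eval_C, map_mul, MvPolynomial.eval_C]
      simp only [map_natCast, Pi.smul_apply, smul_eq_mul, η, Units.val_mk0, pow_add]
      ring

theorem exists_isGeneralExpression {N : ℕ} (A : Matrix (Fin N) (Fin N) ℚ) :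
    ∃ f : Fin N → ExpPoly N, IsGeneralExpression A f := by
  set s := zeroMult A with hs
  let B : Matrix (Fin N) (Fin N) ℂ := A.map (algebraMap ℚ ℂ)
  let φ : Module.End ℂ (Fin N → ℂ) := Matrix.toLin' B
  obtain ⟨q, hq, hq0⟩ := Polynomial.exists_eq_pow_rootMultiplicity_mul_and_not_dvd A.charpoly
    A.charpoly_monic.ne_zero 0
  rw [Polynomial.C_0, sub_zero] at hq hq0
  have hφ : Polynomial.aeval φ (Polynomial.X ^ s * q.map (algebraMap ℚ ℂ)) = 0 := by
    have h1 : Polynomial.X ^ s * q.map (algebraMap ℚ ℂ) = φ.charpoly := by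
      rw [Matrix.charpoly_toLin', Matrix.charpoly_map]
      conv_rhs => rw [hq]
      simp [hs, zeroMult]
    rw [h1]
    exact LinearMap.aeval_self_charpoly φ
  have hq1 : (q.map (algebraMap ℚ ℂ)).eval 0 ≠ 0 := by
    rw [Polynomial.X_dvd_iff, Polynomial.coeff_zero_eq_eval_zero] at hq0
    rw [Polynomial.eval_zero_map]
    simpa using hq0
  choose g hg using fun i : Fin N => exists_repr_pow φ s _ hq1 hφ (Pi.single i 1)
  refine ⟨fun j => ∑ i, MonoidAlgebra.single 1 (Polynomial.C (MvPolynomial.X i)) * g i j,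
    fun X n j => ?_⟩
  have hstep : ∀ k : ℕ, (fun j => (((step A)^[k] X j : ℝ) : ℂ)) = (φ ^ k) (fun j => (X j : ℂ)) := by
    intro k
    induction k with
    | zero => simp
    | succ k ih =>
      rw [Function.iterate_succ_apply', pow_succ', Module.End.mul_apply, ← ih]
      ext j
      simp [φ, B, step, Matrix.mulVec, dotProduct]
  have h2 := congrFun (hstep (n + s)) j
  refine Eq.trans ?_ h2.symm
  have hX : (fun j => (X j : ℂ)) = ∑ i, (X i : ℂ) • (Pi.single i 1 : Fin N → ℂ) := by
    ext j
    simp [Finset.sum_apply, Pi.single_apply]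
  rw [hX, map_sum, map_sum, Finset.sum_apply]
  refine Finset.sum_congr rfl fun i _ => ?_
  rw [map_mul, evalAt_single, hg, map_smul]
  simp

/-- The general expression of `A ^ (n + s) X`, with `X` and `n` symbolic.  (It is unique, because
the functions `n ↦ n ^ l * η ^ n` for distinct pairs `(η, l)` are linearly independent.) -/
def generalExpression {N : ℕ} (A : Matrix (Fin N) (Fin N) ℚ) : Fin N → ExpPoly N :=
  Classical.choose (exists_isGeneralExpression A)

/-- The expression `P_i(X, n) = ∑ p_{iη}(X, n) η ^ n` obtained by substituting `A ^ (n + s) X`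
for `X` in the `i`-th guard polynomial. -/
def guardExpr {N m : ℕ} (A : Matrix (Fin N) (Fin N) ℚ)
    (P : Fin m → MvPolynomial (Fin N) ℚ) (i : Fin m) : ExpPoly N :=
  MvPolynomial.aeval (generalExpression A) (P i)

/-! ### Periods and rationally independent frequencies -/

/-- `e(x) = exp(2πix)`. -/
def e (x : ℝ) : ℂ := Complex.exp (2 * Real.pi * x * Complex.I)

/-- The modulus `|η|`. -/
def modulus (η : ℂˣ) : ℝ := ‖(η : ℂ)‖

/-- The number `α ∈ (-1/2, 1/2]` with `η = |η| e(α)`. -/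
def angle (η : ℂˣ) : ℝ := Complex.arg (η : ℂ) / (2 * Real.pi)

/-- Rational independence of `θ₁, …, θ_d`: no nontrivial rational combination is rational. -/
def RationallyIndependent {d : ℕ} (θ : Fin d → ℝ) : Prop :=
  ∀ a : Fin d → ℚ, (∃ c : ℚ, ∑ i, (a i : ℝ) * θ i = (c : ℝ)) → a = 0

/-- The choices made when the expression `F = ∑ p_η(X, n) η ^ n` is expanded along residue classes
`n ↦ T n + t`: a common period `T` of all the `e(α_η)` with `α_η` rational, and, for every modulus
`r`, a rationally independent family `θ` such that, on every residue class modulo `T`, each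
`e(n α_η)` with `|η| = r` and `α_η` irrational is a constant multiple of a monomial
`∏ e(n θ_i) ^ b_i`. -/
structure Frequencies {N : ℕ} (F : ExpPoly N) where
  T : ℕ
  T_pos : 0 < T
  period : ∀ η ∈ F.coeff.support, ¬ Irrational (angle η) → ∃ k : ℤ, T * angle η = k
  /-- the number of frequencies used for the modulus `r` -/
  dim : ℝ → ℕ
  /-- the frequencies used for the modulus `r` -/
  θ : (r : ℝ) → Fin (dim r) → ℝ
  indep : ∀ r, RationallyIndependent (θ r)
  /-- the exponents of the monomial belonging to `η` -/
  b : (r : ℝ) → ℂˣ → Fin (dim r) → ℤ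
  b_spec : ∀ r, ∀ η ∈ F.coeff.support, modulus η = r → Irrational (angle η) →
    ∃ k : ℤ, T * (angle η - ∑ i, (b r η i : ℝ) * θ r i) = k

/-! ### The coefficients of `G(X, n) = F(X, T n + t)`

For `t < T`, `G(X, n) = F(X, T n + t)` is collected as `∑ C_{r,l}(X, n) n ^ l r ^ (T n + t)`, where
`r` runs over the moduli of the `η` in `F`, and `C_{r,l} = C⁰_{r,l} + C¹_{r,l} + C²_{r,l}` according
to whether `α_η` is zero, rational and nonzero, or irrational.  All of these are real-valued, so
that taking real parts only serves to land in `ℝ`. -/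

section Coefficients

variable {N : ℕ} {F : ExpPoly N} (D : Frequencies F) (t : ℕ)

/-- The coefficient of `n ^ l` in `p_η(X, T n + t)`. -/
def polyCoeff (η : ℂˣ) (l : ℕ) (X : Fin N → ℝ) : ℂ :=
  MvPolynomial.eval (fun i => (X i : ℂ))
    (((F.coeff η).comp (Polynomial.C (D.T : MvPolynomial (Fin N) ℂ) * Polynomial.X +
      Polynomial.C (t : MvPolynomial (Fin N) ℂ))).coeff l)

open Classical in
/-- The part of the coefficient of `n ^ l r ^ (T n + t)` without any `e((T n + t) α)`. -/
def C0 (r : ℝ) (l : ℕ) (X : Fin N → ℝ) : ℝ :=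
  (∑ η ∈ F.coeff.support with modulus η = r ∧ angle η = 0, polyCoeff D t η l X).re

open Classical in
/-- The part with the `e((T n + t) α) = e(t α)` for `α` rational. -/
def C1 (r : ℝ) (l : ℕ) (X : Fin N → ℝ) : ℝ :=
  (∑ η ∈ F.coeff.support with modulus η = r ∧ angle η ≠ 0 ∧ ¬ Irrational (angle η),
    polyCoeff D t η l X * e (t * angle η)).re

open Classical in
/-- The part with the `e((T n + t) α)` for `α` irrational. -/
def C2 (r : ℝ) (l : ℕ) (X : Fin N → ℝ) (n : ℕ) : ℝ :=
  (∑ η ∈ F.coeff.support with modulus η = r ∧ Irrational (angle η),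
    polyCoeff D t η l X * e ((D.T * n + t : ℕ) * angle η)).re

open Classical in
/-- `C2` as a trigonometric polynomial on the torus: `y_i = y_{i2} + y_{i1} √-1` with
`y_{i1} ^ 2 + y_{i2} ^ 2 = 1` stands for `e((T n + t) θ_i)`. -/
def C2Torus (r : ℝ) (l : ℕ) (X : Fin N → ℝ) (y : Fin (D.dim r) → Circle) : ℝ :=
  (∑ η ∈ F.coeff.support with modulus η = r ∧ Irrational (angle η),
    polyCoeff D t η l X * e (t * (angle η - ∑ i, (D.b r η i : ℝ) * D.θ r i)) *
      ∏ i, (y i : ℂ) ^ (D.b r η i)).re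

/-- The minimum of `C0 + C1 + C2` over the torus (attained, see `isLeast_torusMin`). -/
def torusMin (r : ℝ) (l : ℕ) (X : Fin N → ℝ) : ℝ :=
  ⨅ y : Fin (D.dim r) → Circle, (C0 D t r l X + C1 D t r l X + C2Torus D t r l X y)

theorem isLeast_torusMin (r : ℝ) (l : ℕ) (X : Fin N → ℝ) :
    IsLeast (Set.range fun y : Fin (D.dim r) → Circle =>
      C0 D t r l X + C1 D t r l X + C2Torus D t r l X y) (torusMin D t r l X) := by
  have hc : Continuous fun y : Fin (D.dim r) → Circle =>
      C0 D t r l X + C1 D t r l X + C2Torus D t r l X y := by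
    unfold C2Torus
    refine continuous_const.add (Complex.continuous_re.comp ?_)
    refine continuous_finsetSum _ fun η _ => continuous_const.mul ?_
    refine continuous_finsetProd _ fun i _ => ?_
    exact (continuous_subtype_val.comp (continuous_apply i)).zpow₀ _
      fun y => Or.inl (Circle.coe_ne_zero _)
  exact (isCompact_range hc).isLeast_sInf (Set.range_nonempty _)

/-- `C_{r,l}(X, n) ≻ 0`. -/
def Positive (r : ℝ) (l : ℕ) (X : Fin N → ℝ) : Prop := 0 < torusMin D t r l X

/-- `C_{r,l}(X, n) ⪰ 0`. -/
def Nonnegative (r : ℝ) (l : ℕ) (X : Fin N → ℝ) : Prop := 0 ≤ torusMin D t r l X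

end Coefficients

open Classical in
/-- The pairs `(r, l)` for which a term `n ^ l r ^ n` occurs. -/
def terms {N : ℕ} (F : ExpPoly N) : Finset (ℝ × ℕ) :=
  F.coeff.support.biUnion fun η =>
    (Finset.range ((F.coeff η).natDegree + 1)).image fun l => (modulus η, l)

/-- The ordering of the terms `n ^ l r ^ n` by growth. -/
def TermLT (κ κ' : ℝ × ℕ) : Prop := κ.1 < κ'.1 ∨ (κ.1 = κ'.1 ∧ κ.2 < κ'.2)

/-! ### The algorithm -/

section Algorithm

variable {N m : ℕ} {A : Matrix (Fin N) (Fin N) ℚ} {P : Fin m → MvPolynomial (Fin N) ℚ}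

/-- The system `S_j` for `G(X, n) = F(X, T n + t)` and the guessed leading term `κ`. -/
def LeadingSystem {F : ExpPoly N} (D : Frequencies F) (t : ℕ) (κ : ℝ × ℕ) (X : Fin N → ℝ) :
    Prop :=
  Positive D t κ.1 κ.2 X ∧
    ∀ κ' ∈ terms F, TermLT κ κ' → Nonnegative D t κ'.1 κ'.2 X

/-- The two answers of the algorithm. -/
inductive Answer where
  | terminating
  | nonterminating

/-- A guess of a leading term for each of the `G(X, n) = P_i(X, T_i n + t)`, `t < T_i`. -/
def Guess (D : ∀ i, Frequencies (guardExpr A P i)) : Type :=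
  ∀ i, Fin (D i).T → terms (guardExpr A P i)

/-- The system `S` of a guess. -/
def GuessSystem (D : ∀ i, Frequencies (guardExpr A P i)) (g : Guess D) (X : Fin N → ℝ) : Prop :=
  ∀ (i : Fin m) (t : Fin (D i).T), LeadingSystem (D i) t (g i t : ℝ × ℕ) X

open Classical in
/-- The output of the algorithm `Termination`: "nonterminating" if the system of one of the
(finitely many) guesses has a real solution, "terminating" otherwise. -/
def termination (D : ∀ i, Frequencies (guardExpr A P i)) : Answer :=
  if ∃ g : Guess D, ∃ X : Fin N → ℝ, GuessSystem D g X then Answer.nonterminating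
  else Answer.terminating

/-- The assumption for the main algorithm: for every input and every coefficient, if the part with
irrational angles is not identically zero, then the minimum over the torus is nonzero. -/
def MainAssumption (D : ∀ i, Frequencies (guardExpr A P i)) : Prop :=
  ∀ (X : Fin N → ℝ) (i : Fin m) (t : Fin (D i).T), ∀ κ ∈ terms (guardExpr A P i),
    (∃ n : ℕ, C2 (D i) t κ.1 κ.2 X n ≠ 0) → torusMin (D i) t κ.1 κ.2 X ≠ 0

end Algorithm

end

end LinearLoop

namespace LinearLoop

open Filter Topology

noncomputable section

/-! ### Density of the orbit of a rationally independent rotation of the torus -/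

/-! On a residue class modulo `T`, a guard value is a finite sum of scales `n ^ l * r ^ (T * n + t)`
with real coefficients bounded in `n` (`evalAt_re_eq_sum_terms`), and a larger scale dominates every
smaller one (`isLittleO_term`). The coefficient is a continuous function on a torus sampled along a
rotation (`C2_eq_C2Torus`). Rational independence makes the orbit dense, even along an arithmetic
progression (`frequently_torusPoint_mem`), so the torus minimum is the exact infimum of the
coefficient and is approached infinitely often (`frequently_coeffAt_lt`).

A solution of a guess system has a leading coefficient bounded below by a positive constant and
nonnegative coefficients above it, so every guard is eventually positive; a late enough iterate is
then a nonterminating input. This needs no Assumption.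

Conversely, let all guards stay positive from `X`. In each class take the largest scale with nonzero
minimum. Under the Assumption a zero minimum forces the whole coefficient to vanish, so that scale
leads; a negative minimum would make the guard nonpositive at some time. Hence the minimum is
positive and `X` solves the system of that guess. Without the Assumption, a coefficient with zero
minimum could come close to zero infinitely often without vanishing, leaving the sign to smaller
scales. -/

theorem norm_geom_sum_le {z : ℂ} (hz : ‖z‖ = 1) (hz1 : z ≠ 1) (k : ℕ) :
    ‖∑ n ∈ Finset.range k, z ^ n‖ ≤ 2 / ‖z - 1‖ := by
  rw [geom_sum_eq hz1, norm_div]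
  gcongr
  calc ‖z ^ k - 1‖ ≤ ‖z ^ k‖ + ‖(1 : ℂ)‖ := norm_sub_le _ _
    _ = 2 := by simp [hz]; norm_num

theorem tendsto_inv_mul_geom_sum {z : ℂ} (hz : ‖z‖ = 1) (hz1 : z ≠ 1) (c : ℂ) :
    Tendsto (fun k : ℕ => (k : ℂ)⁻¹ * ∑ n ∈ Finset.range k, c * z ^ n) atTop (𝓝 0) := by
  have h : Tendsto (fun k : ℕ => (k : ℝ)⁻¹ * (‖c‖ * (2 / ‖z - 1‖))) atTop (𝓝 0) := by
    simpa using (tendsto_inv_atTop_nhds_zero_nat (𝕜 := ℝ)).mul_const (‖c‖ * (2 / ‖z - 1‖))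
  refine squeeze_zero_norm (fun k => ?_) h
  rw [← Finset.mul_sum, norm_mul, norm_mul, norm_inv, Complex.norm_natCast]
  gcongr
  exact norm_geom_sum_le hz hz1 k

/-- The mean of the first `k` values of `f` along the sequence `x` translated by `y`. -/
def translatedMean {G : Type*} [TopologicalSpace G] [Add G] (x : ℕ → G) (f : C(G, ℂ)) (y : G)
    (k : ℕ) : ℂ :=
  (k : ℂ)⁻¹ * ∑ n ∈ Finset.range k, f (x n + y)

section TranslatedMean

variable {G : Type*} [TopologicalSpace G] [Add G] (x : ℕ → G)

theorem norm_translatedMean_le [CompactSpace G] (f : C(G, ℂ)) (y : G) (k : ℕ) :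
    ‖translatedMean x f y k‖ ≤ ‖f‖ := by
  rcases k.eq_zero_or_pos with rfl | hk
  · simp [translatedMean]
  have hk' : (0 : ℝ) < k := by exact_mod_cast hk
  rw [translatedMean, norm_mul, norm_inv, Complex.norm_natCast, inv_mul_le_iff₀ hk']
  refine (norm_sum_le _ _).trans ?_
  refine (Finset.sum_le_sum fun n _ => f.norm_coe_le_norm (x n + y)).trans ?_
  simp

theorem translatedMean_add (f g : C(G, ℂ)) (y : G) (k : ℕ) :
    translatedMean x (f + g) y k = translatedMean x f y k + translatedMean x g y k := by
  simp [translatedMean, Finset.sum_add_distrib, mul_add]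

theorem translatedMean_sub (f g : C(G, ℂ)) (y : G) (k : ℕ) :
    translatedMean x (f - g) y k = translatedMean x f y k - translatedMean x g y k := by
  simp [translatedMean, Finset.sum_sub_distrib, mul_sub]

theorem translatedMean_smul (c : ℂ) (f : C(G, ℂ)) (y : G) (k : ℕ) :
    translatedMean x (c • f) y k = c * translatedMean x f y k := by
  simp only [translatedMean, ContinuousMap.coe_smul, Pi.smul_apply, smul_eq_mul, ← Finset.mul_sum]
  ring

/-- Asymptotic translation invariance of the means passes from a set of functions to the closure of
its linear span. -/
theorem tendsto_translatedMean_sub [CompactSpace G] {S : Set C(G, ℂ)} (y y' : G)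
    (hS : ∀ f ∈ S,
      Tendsto (fun k => translatedMean x f y k - translatedMean x f y' k) atTop (𝓝 0))
    {f : C(G, ℂ)} (hf : f ∈ (Submodule.span ℂ S).topologicalClosure) :
    Tendsto (fun k => translatedMean x f y k - translatedMean x f y' k) atTop (𝓝 0) := by
  have hspan : ∀ g ∈ Submodule.span ℂ S,
      Tendsto (fun k => translatedMean x g y k - translatedMean x g y' k) atTop (𝓝 0) := by
    intro g hg
    induction hg using Submodule.span_induction with
    | mem g hg => exact hS g hg
    | zero => simp [translatedMean]
    | add g h _ _ hg hh =>
      simp only [translatedMean_add]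
      simpa [add_sub_add_comm] using hg.add hh
    | smul c g _ hg =>
      simp only [translatedMean_smul, ← mul_sub]
      simpa using hg.const_mul c
  rw [Metric.tendsto_atTop]
  intro ε hε
  -- Means are bounded by the sup norm uniformly in `k`, so replacing `f` by `g` costs less than `ε
  -- / 3` at each of the two translates.
  obtain ⟨g, hg, hfg⟩ := Metric.mem_closure_iff.1 hf (ε / 3) (by positivity)
  obtain ⟨K, hK⟩ := Metric.tendsto_atTop.1 (hspan g hg) (ε / 3) (by positivity)
  refine ⟨K, fun k hk => ?_⟩
  have h1 := hK k hk
  rw [dist_zero_right] at h1 ⊢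
  rw [dist_eq_norm] at hfg
  have h2 := norm_translatedMean_le x (f - g) y k
  have h3 := norm_translatedMean_le x (f - g) y' k
  rw [translatedMean_sub] at h2 h3
  calc ‖translatedMean x f y k - translatedMean x f y' k‖
      = ‖(translatedMean x f y k - translatedMean x g y k) +
        (translatedMean x g y k - translatedMean x g y' k) -
        (translatedMean x f y' k - translatedMean x g y' k)‖ := by congr 1; ring
    _ ≤ ‖translatedMean x f y k - translatedMean x g y k‖ +
        ‖translatedMean x g y k - translatedMean x g y' k‖ +
        ‖translatedMean x f y' k - translatedMean x g y' k‖ :=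
      (norm_sub_le _ _).trans (by gcongr; exact norm_add_le _ _)
    _ < ε := by linarith

end TranslatedMean

/-- If the means of every continuous function along `x` are asymptotically translation invariant,
then `x` visits every nonempty open set infinitely often. -/
theorem frequently_mem_of_tendsto_translatedMean_sub {G : Type*} [TopologicalSpace G] [AddGroup G]
    [IsTopologicalAddGroup G] [CompactSpace G] [T2Space G] (x : ℕ → G)
    (hx : ∀ (f : C(G, ℂ)) (y : G),
      Tendsto (fun k => translatedMean x f y k - translatedMean x f 0 k) atTop (𝓝 0))
    {U : Set G} (hU : IsOpen U) (hne : U.Nonempty) : ∃ᶠ n in atTop, x n ∈ U := by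
  obtain ⟨u, hu⟩ := hne
  -- A bump supported in `U`: if `x` eventually avoids `U`, its means tend to `0`, and by invariance
  -- so do those of all its translates.
  obtain ⟨f, hf0, hf1, hf⟩ := exists_continuous_zero_one_of_isClosed (s := Uᶜ) (t := {u})
    hU.isClosed_compl isClosed_singleton (by simpa using hu)
  intro hev
  obtain ⟨n₀, hn₀⟩ := eventually_atTop.1 hev
  let F : C(G, ℂ) := ⟨fun z => (f z : ℂ), by fun_prop⟩
  have hF0 : Tendsto (fun k => translatedMean x F 0 k) atTop (𝓝 0) := by
    have h : Tendsto (fun k : ℕ => (k : ℂ)⁻¹ * ∑ n ∈ Finset.range n₀, F (x n + 0)) atTop (𝓝 0) := by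
      simpa using (tendsto_inv_atTop_nhds_zero_nat (𝕜 := ℂ)).mul_const
        (∑ n ∈ Finset.range n₀, F (x n + 0))
    refine h.congr' ?_
    filter_upwards [eventually_ge_atTop n₀] with k hk
    rw [translatedMean]
    congr 1
    refine Finset.sum_subset (Finset.range_subset_range.2 hk) fun n _ hn => ?_
    have := hf0 (hn₀ n (by simpa using hn))
    simpa [F] using this
  have hF : ∀ y, Tendsto (fun k => translatedMean x F y k) atTop (𝓝 0) := fun y => by
    simpa using (hx F y).add hF0
  -- Finitely many translates of the bump sum to at least `1 / 2` everywhere, so their means cannot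
  -- all tend to `0`. This replaces an argument by Haar measure.
  obtain ⟨s, hs⟩ := isCompact_univ.elim_finite_subcover
    (fun y : G => {z | 1 / 2 < f (z + y)})
    (fun y => isOpen_lt continuous_const (by fun_prop))
    (fun z _ => Set.mem_iUnion.2 ⟨-z + u, by
      have := hf1 (Set.mem_singleton u)
      simp only [Pi.one_apply] at this
      norm_num [this]⟩)
  have hsum : Tendsto (fun k => ∑ y ∈ s, (translatedMean x F y k).re) atTop (𝓝 0) := by
    simpa using tendsto_finsetSum s fun y _ => (Complex.continuous_re.tendsto _).comp (hF y)
  have hge : ∀ k : ℕ, 0 < k → 1 / 2 ≤ ∑ y ∈ s, (translatedMean x F y k).re := by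
    intro k hk
    have hk' : (0 : ℝ) < k := by exact_mod_cast hk
    have h1 : ∀ y, (translatedMean x F y k).re = (k : ℝ)⁻¹ * ∑ n ∈ Finset.range k, f (x n + y) := by
      intro y
      have : translatedMean x F y k
          = (((k : ℝ)⁻¹ * ∑ n ∈ Finset.range k, f (x n + y) : ℝ) : ℂ) := by
        simp [translatedMean, F]
      rw [this, Complex.ofReal_re]
    simp only [h1]
    rw [← Finset.mul_sum, Finset.sum_comm, le_inv_mul_iff₀ hk']
    have h2 : ∀ n ∈ Finset.range k, (1 / 2 : ℝ) ≤ ∑ y ∈ s, f (x n + y) := by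
      intro n _
      obtain ⟨y, hy, hy'⟩ := Set.mem_iUnion₂.1 (hs (Set.mem_univ (x n)))
      exact (le_of_lt hy').trans
        (Finset.single_le_sum (f := fun y => f (x n + y)) (fun y _ => (hf _).1) hy)
    simpa using Finset.sum_le_sum h2
  have := ge_of_tendsto hsum (eventually_atTop.2 ⟨1, fun k hk => hge k hk⟩)
  norm_num at this

theorem e_add (x y : ℝ) : e (x + y) = e x * e y := by
  simp only [e, ← Complex.exp_add]
  congr 1
  push_cast
  ring

theorem norm_e (x : ℝ) : ‖e x‖ = 1 := by
  have : e x = Complex.exp ((2 * Real.pi * x : ℝ) * Complex.I) := by simp [e]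
  rw [this, Complex.norm_exp_ofReal_mul_I]

theorem e_eq_one_iff (x : ℝ) : e x = 1 ↔ ∃ k : ℤ, x = k := by
  rw [e, Complex.exp_eq_one_iff]
  refine exists_congr fun k => ?_
  have h : (2 * Real.pi * Complex.I : ℂ) ≠ 0 := Complex.two_pi_I_ne_zero
  constructor
  · intro hk
    have : (x : ℂ) = k := by
      apply mul_left_cancel₀ h
      linear_combination hk
    exact_mod_cast this
  · rintro rfl
    push_cast
    ring

theorem e_nat_mul (n : ℕ) (x : ℝ) : e (n * x) = e x ^ n := by
  rw [e, e, ← Complex.exp_nat_mul]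
  congr 1
  push_cast
  ring

theorem e_int_mul (n : ℤ) (x : ℝ) : e (n * x) = e x ^ n := by
  rw [e, e, ← Complex.exp_int_mul]
  congr 1
  push_cast
  ring

theorem e_sum {ι : Type*} (s : Finset ι) (f : ι → ℝ) : e (∑ i ∈ s, f i) = ∏ i ∈ s, e (f i) := by
  classical
  induction s using Finset.induction_on with
  | empty => simp [e]
  | insert i s hi ih => rw [Finset.sum_insert hi, Finset.prod_insert hi, e_add, ih]

theorem fourier_coe_eq_e (k : ℤ) (x : ℝ) : fourier k (x : UnitAddCircle) = e (k * x) := by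
  rw [fourier_coe_apply, e]
  congr 1
  push_cast
  ring

/-- The point `(e(s θ₁), …, e(s θ_d))` of the torus. -/
def torusPoint {d : ℕ} (θ : Fin d → ℝ) (s : ℝ) : Fin d → Circle :=
  fun i => AddCircle.toCircle ((s * θ i : ℝ) : UnitAddCircle)

theorem coe_torusPoint {d : ℕ} (θ : Fin d → ℝ) (s : ℝ) (i : Fin d) :
    (torusPoint θ s i : ℂ) = e (s * θ i) := by
  have := fourier_coe_eq_e 1 (s * θ i)
  rw [fourier_one] at this
  simpa [torusPoint] using this

/-- **Kronecker's theorem**: along an arithmetic progression, the multiples of a rationally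
independent family visit every nonempty open subset of the torus infinitely often. -/
theorem frequently_torusPoint_mem {d : ℕ} {θ : Fin d → ℝ} (hθ : RationallyIndependent θ)
    {T : ℕ} (hT : 0 < T) (t : ℕ) {U : Set (Fin d → Circle)} (hU : IsOpen U) (hne : U.Nonempty) :
    ∃ᶠ n : ℕ in atTop, torusPoint θ (T * n + t : ℕ) ∈ U := by
  let x : ℕ → UnitAddTorus (Fin d) := fun n i => (((T * n + t : ℕ) * θ i : ℝ) : UnitAddCircle)
  let φ : UnitAddTorus (Fin d) → Fin d → Circle := fun z i => AddCircle.toCircle (z i)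
  have hφ : Continuous φ :=
    continuous_pi fun i => AddCircle.continuous_toCircle.comp (continuous_apply i)
  have hφs : Function.Surjective φ := by
    intro w
    refine ⟨fun i => (AddCircle.homeomorphCircle (T := (1 : ℝ)) one_ne_zero).symm (w i), ?_⟩
    ext i
    have := (AddCircle.homeomorphCircle (T := (1 : ℝ)) one_ne_zero).apply_symm_apply (w i)
    rw [AddCircle.homeomorphCircle_apply] at this
    exact congrArg Subtype.val this
  refine frequently_mem_of_tendsto_translatedMean_sub x (fun f y => ?_) (hU.preimage hφ)
    (hne.preimage hφs)
  refine tendsto_translatedMean_sub x y 0 (S := Set.range UnitAddTorus.mFourier) ?_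
    (by rw [UnitAddTorus.span_mFourier_closure_eq_top]; trivial)
  rintro _ ⟨b, rfl⟩
  by_cases hb : b = 0
  · subst hb
    simp [UnitAddTorus.mFourier_zero, translatedMean]
  set σ : ℝ := ∑ i, (b i : ℝ) * θ i with hσ
  -- Otherwise `T * σ` is an integer `k`, and `σ = k / T` is a nontrivial rational combination of
  -- the `θ i` with rational value. Along `x` the character is thus a geometric progression of ratio
  -- different from `1`, and its means vanish in the limit.
  have hz1 : e (T * σ) ≠ 1 := by
    rw [Ne, e_eq_one_iff]
    rintro ⟨k, hk⟩
    have hT' : (T : ℝ) ≠ 0 := by exact_mod_cast hT.ne'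
    have := hθ (fun i => (b i : ℚ)) ⟨k / T, by
      push_cast
      rw [← hσ, eq_div_iff hT', mul_comm, hk]⟩
    exact hb (funext fun i => by simpa using congrFun this i)
  have hval : ∀ (n : ℕ) (y : UnitAddTorus (Fin d)), UnitAddTorus.mFourier b (x n + y) =
      e (t * σ) * UnitAddTorus.mFourier b y * e (T * σ) ^ n := by
    intro n y
    have h1 : UnitAddTorus.mFourier b (x n + y) =
        UnitAddTorus.mFourier b (x n) * UnitAddTorus.mFourier b y := by
      simp only [UnitAddTorus.mFourier, ContinuousMap.coe_mk, ← Finset.prod_mul_distrib]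
      refine Finset.prod_congr rfl fun i _ => ?_
      simp only [fourier_apply, Pi.add_apply, smul_add, AddCircle.toCircle_add, Circle.coe_mul]
    have h2 : UnitAddTorus.mFourier b (x n) = e (t * σ) * e (T * σ) ^ n := by
      simp only [UnitAddTorus.mFourier, ContinuousMap.coe_mk, x, fourier_coe_eq_e]
      rw [← e_sum, ← e_nat_mul, ← e_add]
      congr 1
      rw [hσ]
      simp only [Finset.mul_sum, ← Finset.sum_add_distrib]
      refine Finset.sum_congr rfl fun i _ => ?_
      push_cast
      ring
    rw [h1, h2]
    ring
  have hlim : ∀ y, Tendsto (fun k => translatedMean x (UnitAddTorus.mFourier b) y k) atTop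
      (𝓝 0) := by
    intro y
    simp only [translatedMean, hval]
    exact tendsto_inv_mul_geom_sum (norm_e _) hz1 _
  simpa using (hlim y).sub (hlim 0)

/-! ### Existence of periods and rationally independent frequencies -/

theorem exists_common_denominator {ι : Type*} (s : Finset ι) (c : ι → ℚ) :
    ∃ M : ℕ, 0 < M ∧ ∀ i ∈ s, ∃ k : ℤ, (M : ℚ) * c i = k := by
  classical
  refine ⟨∏ i ∈ s, (c i).den, Finset.prod_pos fun i _ => (c i).den_pos, fun i hi => ?_⟩
  refine ⟨(∏ j ∈ s.erase i, (c j).den : ℕ) * (c i).num, ?_⟩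
  rw [← Finset.mul_prod_erase s _ hi]
  push_cast
  have := Rat.den_mul_eq_num (c i)
  rw [← this]
  ring

/-- Finitely many real numbers are, up to rational numbers, integral combinations of a rationally
independent family. -/
theorem exists_rationallyIndependent {ι : Type*} (s : Finset ι) (α : ι → ℝ) :
    ∃ (d : ℕ) (θ : Fin d → ℝ), RationallyIndependent θ ∧
      ∃ b : ι → Fin d → ℤ, ∀ i ∈ s, ∃ q : ℚ, α i - ∑ j, (b i j : ℝ) * θ j = q := by
  classical
  -- Rational independence is linear independence in `ℝ ⧸ ℚ`, so lifts of a basis of the span of the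
  -- classes of the `α i` are rationally independent.
  let Q : Submodule ℚ ℝ := Submodule.span ℚ {1}
  have hQ : ∀ x : ℝ, Q.mkQ x = 0 ↔ ∃ q : ℚ, x = q := by
    intro x
    rw [Submodule.mkQ_apply, Submodule.Quotient.mk_eq_zero, Submodule.mem_span_singleton]
    refine exists_congr fun q => ?_
    rw [Rat.smul_def, mul_one, eq_comm]
  let W : Submodule ℚ (ℝ ⧸ Q) := Submodule.span ℚ ((s.image fun i => Q.mkQ (α i) : Finset (ℝ ⧸ Q)))
  have hW : ∀ i ∈ s, Q.mkQ (α i) ∈ W := fun i hi =>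
    Submodule.subset_span (by exact_mod_cast Finset.mem_image_of_mem (fun i => Q.mkQ (α i)) hi)
  let B := Module.finBasis ℚ W
  choose v hv using fun j => Q.mkQ_surjective (B j : ℝ ⧸ Q)
  let c : ι → Fin (Module.finrank ℚ W) → ℚ := fun i j =>
    if h : i ∈ s then B.repr ⟨Q.mkQ (α i), hW i h⟩ j else 0
  -- Coordinates in the basis are only rational; dividing the basis vectors by a common denominator
  -- `M` makes them integral.
  obtain ⟨M, hM, hMc⟩ := exists_common_denominator (s ×ˢ Finset.univ)
    fun p : ι × Fin (Module.finrank ℚ W) => c p.1 p.2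
  have hMR : (M : ℝ) ≠ 0 := by exact_mod_cast hM.ne'
  have hMQ : (M : ℚ) ≠ 0 := by exact_mod_cast hM.ne'
  refine ⟨_, fun j => v j / M, ?_, fun i j => (M * c i j).num, fun i hi => ?_⟩
  · rintro a ⟨q, hq⟩
    have h1 : Q.mkQ (∑ j, (a j / M) • v j) = 0 := by
      refine (hQ _).2 ⟨q, ?_⟩
      rw [← hq]
      refine Finset.sum_congr rfl fun j _ => ?_
      rw [Rat.smul_def]
      push_cast
      ring
    have h2 : ∑ j, (a j / M) • B j = 0 := by
      apply Subtype.ext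
      rw [map_sum] at h1
      simpa [hv] using h1
    have h3 := Fintype.linearIndependent_iff.1 B.linearIndependent _ h2
    ext j
    simpa [hMQ] using h3 j
  · refine (hQ _).1 ?_
    have h1 : ∀ j, (((M * c i j).num : ℤ) : ℝ) * (v j / M) = (c i j) • v j := by
      intro j
      obtain ⟨k, hk⟩ := hMc (i, j) (by simp [hi])
      simp only at hk
      have hk' : (M : ℝ) * c i j = k := by exact_mod_cast hk
      rw [hk, Rat.num_intCast, ← hk', Rat.smul_def]
      field_simp
    simp only [h1]
    have h2 := congrArg Subtype.val (B.sum_repr ⟨Q.mkQ (α i), hW i hi⟩)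
    rw [map_sub, map_sum, sub_eq_zero]
    refine h2.symm.trans ?_
    rw [AddSubmonoidClass.coe_finsetSum]
    refine Finset.sum_congr rfl fun j _ => ?_
    rw [Submodule.coe_smul, map_smul, hv]
    simp only [c, dif_pos hi]

/-- One family `θ` serves all moduli, and `T` clears the denominators of the rational errors `angle
η - ∑ b θ`. If `angle η` is itself rational, independence forces `b η = 0`, so the same `T` is a
period for it. -/
theorem nonempty_frequencies {N : ℕ} (F : ExpPoly N) : Nonempty (Frequencies F) := by
  obtain ⟨d, θ, hθ, b, hb⟩ := exists_rationallyIndependent F.coeff.support angle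
  choose! q hq using hb
  obtain ⟨T, hT, hTq⟩ := exists_common_denominator F.coeff.support q
  have key : ∀ η ∈ F.coeff.support, ∃ k : ℤ, T * (angle η - ∑ j, (b η j : ℝ) * θ j) = k := by
    intro η hη
    obtain ⟨k, hk⟩ := hTq η hη
    exact ⟨k, by rw [hq η hη]; exact_mod_cast hk⟩
  refine ⟨⟨T, hT, fun η hη hr => ?_, fun _ => d, fun _ => θ, fun _ => hθ, fun _ => b,
    fun _ η hη _ _ => key η hη⟩⟩
  obtain ⟨a, ha⟩ : ∃ a : ℚ, (a : ℝ) = angle η := by simpa [Irrational] using hr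
  have hb0 := hθ (fun j => (b η j : ℚ)) ⟨a - q η, by
    push_cast
    rw [ha, ← hq η hη]
    ring⟩
  have hb0' : ∀ j, b η j = 0 := fun j => by simpa using congrFun hb0 j
  simpa [hb0'] using key η hη

/-! ### The expansion along a residue class -/

theorem modulus_pos (η : ℂˣ) : 0 < modulus η := norm_pos_iff.2 η.ne_zero

theorem coe_eq_modulus_mul_e (η : ℂˣ) : (η : ℂ) = modulus η * e (angle η) := by
  have h : e (angle η) = Complex.exp (Complex.arg η * Complex.I) := by
    rw [e, angle]
    congr 1
    have : (Real.pi : ℂ) ≠ 0 := by exact_mod_cast Real.pi_ne_zero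
    push_cast
    field_simp
  rw [h, modulus, Complex.norm_mul_exp_arg_mul_I]

theorem coe_pow_eq (η : ℂˣ) (n : ℕ) : (η : ℂ) ^ n = (modulus η : ℂ) ^ n * e (n * angle η) := by
  rw [e_nat_mul, ← mul_pow, ← coe_eq_modulus_mul_e]

theorem evalAt_eq_sum {N : ℕ} (X : Fin N → ℝ) (n : ℕ) (F : ExpPoly N) :
    evalAt X n F = ∑ η ∈ F.coeff.support,
      MvPolynomial.eval (fun i => (X i : ℂ))
        ((F.coeff η).eval (n : MvPolynomial (Fin N) ℂ)) * (η : ℂ) ^ n := by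
  conv_lhs => rw [← MonoidAlgebra.sum_coeff_single F]
  rw [Finsupp.sum, map_sum]
  exact Finset.sum_congr rfl fun η _ => evalAt_single X n η _

section Expansion

variable {N : ℕ} {F : ExpPoly N} (D : Frequencies F) (t : ℕ)

theorem natDegree_comp_affine_le (p : Polynomial (MvPolynomial (Fin N) ℂ)) (T t : ℕ) :
    (p.comp (Polynomial.C (T : MvPolynomial (Fin N) ℂ) * Polynomial.X +
      Polynomial.C (t : MvPolynomial (Fin N) ℂ))).natDegree ≤ p.natDegree := by
  refine Polynomial.natDegree_comp_le.trans ?_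
  exact (Nat.mul_le_mul_left _ Polynomial.natDegree_linear_le).trans (by simp)

theorem polyCoeff_eq_zero {η : ℂˣ} {l : ℕ} (hl : (F.coeff η).natDegree < l) (X : Fin N → ℝ) :
    polyCoeff D t η l X = 0 := by
  rw [polyCoeff, Polynomial.coeff_eq_zero_of_natDegree_lt
    ((natDegree_comp_affine_le _ _ _).trans_lt hl), map_zero]

theorem eval_coeff_eq_sum_polyCoeff (η : ℂˣ) (X : Fin N → ℝ) (n : ℕ) :
    MvPolynomial.eval (fun i => (X i : ℂ))
        ((F.coeff η).eval ((D.T * n + t : ℕ) : MvPolynomial (Fin N) ℂ)) =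
      ∑ l ∈ Finset.range ((F.coeff η).natDegree + 1), polyCoeff D t η l X * (n : ℂ) ^ l := by
  have h : (F.coeff η).eval ((D.T * n + t : ℕ) : MvPolynomial (Fin N) ℂ) =
      ((F.coeff η).comp (Polynomial.C (D.T : MvPolynomial (Fin N) ℂ) * Polynomial.X +
        Polynomial.C (t : MvPolynomial (Fin N) ℂ))).eval (n : MvPolynomial (Fin N) ℂ) := by
    simp [Polynomial.eval_comp]
  rw [h, Polynomial.eval_eq_sum_range' (Nat.lt_succ_of_le (natDegree_comp_affine_le _ _ _)),
    map_sum]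
  refine Finset.sum_congr rfl fun l _ => ?_
  rw [map_mul, map_pow, polyCoeff,
    map_natCast (MvPolynomial.eval fun i => (X i : ℂ))]

/-- The coefficient `C_{r,l}(X, n)` of `n ^ l r ^ (T n + t)`. -/
def coeffAt (r : ℝ) (l : ℕ) (X : Fin N → ℝ) (n : ℕ) : ℝ :=
  C0 D t r l X + C1 D t r l X + C2 D t r l X n

theorem e_add_of_int {x y : ℝ} (h : ∃ k : ℤ, x = k) : e (x + y) = e y := by
  rw [e_add, (e_eq_one_iff x).2 h, one_mul]

theorem e_progression {T : ℕ} {x : ℝ} (h : ∃ k : ℤ, T * x = k) (n t : ℕ) :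
    e ((T * n + t : ℕ) * x) = e (t * x) := by
  obtain ⟨k, hk⟩ := h
  rw [← e_add_of_int (x := n * k) (y := t * x) ⟨n * k, by push_cast; ring⟩, ← hk]
  congr 1
  push_cast
  ring

-- The split into `C0`, `C1`, `C2` loses nothing: since `T` is a period of the rational angles, `e
-- ((T * n + t) * α)` equals `e (t * α)` for them.
open Classical in
theorem coeffAt_eq_re (r : ℝ) (l : ℕ) (X : Fin N → ℝ) (n : ℕ) :
    coeffAt D t r l X n = (∑ η ∈ F.coeff.support with modulus η = r,
      polyCoeff D t η l X * e ((D.T * n + t : ℕ) * angle η)).re := by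
  rw [coeffAt, C0, C1, C2, ← Complex.add_re, ← Complex.add_re]
  congr 1
  simp only [Finset.sum_filter]
  rw [← Finset.sum_add_distrib, ← Finset.sum_add_distrib]
  refine Finset.sum_congr rfl fun η hη => ?_
  by_cases hr : modulus η = r
  swap
  · simp [hr]
  by_cases hi : Irrational (angle η)
  · simp [hr, hi, hi.ne_zero]
  have he := e_progression (D.period η hη hi) n t
  by_cases h0 : angle η = 0
  · simp [hr, h0, e]
  · simp only [hr, h0, hi, not_false_eq_true, and_self, and_false, if_true, if_false, zero_add,
      add_zero, ne_eq, he]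

-- By `b_spec`, the factor `e ((T * n + t) * (α - ∑ b θ))` does not depend on `n`; what remains is a
-- monomial in the coordinates of the torus point.
open Classical in
theorem C2_eq_C2Torus (r : ℝ) (l : ℕ) (X : Fin N → ℝ) (n : ℕ) :
    C2 D t r l X n = C2Torus D t r l X (torusPoint (D.θ r) (D.T * n + t : ℕ)) := by
  rw [C2, C2Torus]
  congr 1
  refine Finset.sum_congr rfl fun η hη => ?_
  obtain ⟨hη, hr, hi⟩ := by simpa only [Finset.mem_filter] using hη
  rw [mul_assoc, ← e_progression (D.b_spec r η hη hr hi) n t]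
  congr 1
  simp only [coe_torusPoint, ← e_int_mul]
  rw [← e_sum, ← e_add]
  congr 1
  rw [mul_sub, Finset.mul_sum, sub_add_eq_add_sub, eq_sub_iff_add_eq]
  congr 1
  exact Finset.sum_congr rfl fun i _ => by ring

theorem torusMin_le_coeffAt (r : ℝ) (l : ℕ) (X : Fin N → ℝ) (n : ℕ) :
    torusMin D t r l X ≤ coeffAt D t r l X n := by
  rw [coeffAt, C2_eq_C2Torus]
  exact (isLeast_torusMin D t r l X).2 ⟨_, rfl⟩

open Classical in
theorem abs_coeffAt_le (r : ℝ) (l : ℕ) (X : Fin N → ℝ) (n : ℕ) :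
    |coeffAt D t r l X n| ≤
      ∑ η ∈ F.coeff.support with modulus η = r, ‖polyCoeff D t η l X‖ := by
  rw [coeffAt_eq_re]
  refine (Complex.abs_re_le_norm _).trans ((norm_sum_le _ _).trans (le_of_eq ?_))
  simp [norm_e]

theorem evalAt_re_eq_sum_terms (X : Fin N → ℝ) (n : ℕ) :
    (evalAt X (D.T * n + t) F).re = ∑ κ ∈ terms F,
      coeffAt D t κ.1 κ.2 X n * ((n : ℝ) ^ κ.2 * κ.1 ^ (D.T * n + t)) := by
  classical
  have h1 : ∀ κ : ℝ × ℕ,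
      coeffAt D t κ.1 κ.2 X n * ((n : ℝ) ^ κ.2 * κ.1 ^ (D.T * n + t)) =
      (∑ η ∈ F.coeff.support, if modulus η = κ.1 then
        polyCoeff D t η κ.2 X * (n : ℂ) ^ κ.2 * (η : ℂ) ^ (D.T * n + t) else 0).re := by
    intro κ
    rw [coeffAt_eq_re, ← Complex.re_mul_ofReal, Finset.sum_mul, Finset.sum_filter]
    congr 1
    refine Finset.sum_congr rfl fun η _ => ?_
    split_ifs with h
    · rw [coe_pow_eq, h]
      push_cast
      ring
    · rfl
  simp only [h1]
  rw [← Complex.re_sum, evalAt_eq_sum, Finset.sum_comm]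
  congr 1
  refine Finset.sum_congr rfl fun η hη => ?_
  rw [eval_coeff_eq_sum_polyCoeff, Finset.sum_mul]
  have h2 := Finset.sum_image (s := Finset.range ((F.coeff η).natDegree + 1))
    (g := fun l => (modulus η, l))
    (f := fun κ : ℝ × ℕ => if modulus η = κ.1 then
      polyCoeff D t η κ.2 X * (n : ℂ) ^ κ.2 * (η : ℂ) ^ (D.T * n + t) else 0)
    (fun a _ b _ h => (Prod.ext_iff.1 h).2)
  simp only [if_true] at h2
  rw [← h2]
  -- For a given `η`, `terms F` also contains other moduli, and exponents above the degree of `p_η`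
  -- coming from other `η'` of the same modulus; these extra summands are zero.
  refine Finset.sum_subset ?_ ?_
  · intro κ hκ
    exact Finset.mem_biUnion.2 ⟨η, hη, by convert hκ⟩
  · intro κ _ hκ
    split_ifs with h
    · rw [polyCoeff_eq_zero D t _ X]
      · simp
      · by_contra hl
        exact hκ (Finset.mem_image.2 ⟨κ.2, by simp; omega, by rw [h]⟩)
    · rfl

theorem term_fst_pos {κ : ℝ × ℕ} (hκ : κ ∈ terms F) : 0 < κ.1 := by
  classical
  simp only [terms, Finset.mem_biUnion, Finset.mem_image] at hκ
  obtain ⟨η, _, l, _, rfl⟩ := hκ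
  exact modulus_pos η

end Expansion

/-! ### Growth of the terms -/

/-- Gives access to the linear order: trichotomy and maxima of finite sets of terms. -/
theorem termLT_iff_toLex_lt {κ κ' : ℝ × ℕ} : TermLT κ κ' ↔ toLex κ < toLex κ' := by
  rw [Prod.Lex.toLex_lt_toLex]
  rfl

theorem isLittleO_term {κ κ' : ℝ × ℕ} (h : TermLT κ κ') (hκ : 0 < κ.1) (hκ' : 0 < κ'.1)
    {T : ℕ} (hT : 0 < T) (t : ℕ) :
    (fun n : ℕ => (n : ℝ) ^ κ.2 * κ.1 ^ (T * n + t)) =o[atTop]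
      fun n : ℕ => (n : ℝ) ^ κ'.2 * κ'.1 ^ (T * n + t) := by
  obtain ⟨r, l⟩ := κ
  obtain ⟨r', l'⟩ := κ'
  simp only at hκ hκ' ⊢
  have e1 : ∀ (a : ℝ) (j : ℕ), (fun n : ℕ => (n : ℝ) ^ j * a ^ (T * n + t)) =
      fun n : ℕ => a ^ t * ((n : ℝ) ^ j * (a ^ T) ^ n) := by
    intro a j
    ext n
    rw [pow_add, pow_mul]
    ring
  rcases h with h | ⟨h, hl⟩
  · simp only at h
    rw [e1, e1]
    refine Asymptotics.IsLittleO.const_mul_left ?_ _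
    refine Asymptotics.IsLittleO.trans_isBigO ?_
      (Asymptotics.isBigO_self_const_mul (by positivity) _ _)
    -- Strictness needs `T ≠ 0`. The exponential gap absorbs `n ^ l`, and the factor `n ^ l'` only
    -- helps once `n ≥ 1`.
    have hlt : ‖r ^ T‖ < r' ^ T := by
      rw [Real.norm_of_nonneg (by positivity)]
      exact pow_lt_pow_left₀ h hκ.le hT.ne'
    refine (isLittleO_pow_const_mul_const_pow_const_pow_of_norm_lt l hlt).trans_isBigO ?_
    refine Asymptotics.IsBigO.of_bound 1 ?_
    filter_upwards [eventually_ge_atTop 1] with n hn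
    have hn' : (1 : ℝ) ≤ n := by exact_mod_cast hn
    rw [one_mul, Real.norm_of_nonneg (by positivity), Real.norm_of_nonneg (by positivity)]
    exact le_mul_of_one_le_left (by positivity) (one_le_pow₀ hn')
  · simp only at h hl
    subst h
    refine Asymptotics.IsLittleO.mul_isBigO ?_ (Asymptotics.isBigO_refl _ _)
    exact (Asymptotics.isLittleO_pow_pow_atTop_of_lt (𝕜 := ℝ) hl).comp_tendsto
      tendsto_natCast_atTop_atTop

open Classical in
/-- The terms below a given one are eventually negligible. -/
theorem eventually_abs_sum_lower_le {S : Finset (ℝ × ℕ)} (hS : ∀ κ ∈ S, 0 < κ.1) {T : ℕ}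
    (hT : 0 < T) (t : ℕ) {c : ℝ × ℕ → ℕ → ℝ} (hc : ∀ κ, ∃ B, ∀ n, |c κ n| ≤ B) {κ₀ : ℝ × ℕ}
    (hκ₀ : κ₀ ∈ S) {ε : ℝ} (hε : 0 < ε) :
    ∀ᶠ n : ℕ in atTop, |∑ κ ∈ S with TermLT κ κ₀, c κ n * ((n : ℝ) ^ κ.2 * κ.1 ^ (T * n + t))| ≤
      ε * ((n : ℝ) ^ κ₀.2 * κ₀.1 ^ (T * n + t)) := by
  have h : (fun n : ℕ => ∑ κ ∈ S with TermLT κ κ₀,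
      c κ n * ((n : ℝ) ^ κ.2 * κ.1 ^ (T * n + t))) =o[atTop]
      fun n : ℕ => (n : ℝ) ^ κ₀.2 * κ₀.1 ^ (T * n + t) := by
    suffices hterm : ∀ κ ∈ S.filter (fun κ => TermLT κ κ₀),
        (fun n : ℕ => c κ n * ((n : ℝ) ^ κ.2 * κ.1 ^ (T * n + t))) =o[atTop]
        fun n : ℕ => (n : ℝ) ^ κ₀.2 * κ₀.1 ^ (T * n + t) from
        Asymptotics.IsLittleO.fun_sum hterm
    intro κ hκ
    obtain ⟨hκ, hlt⟩ := Finset.mem_filter.1 hκ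
    obtain ⟨B, hB⟩ := hc κ
    have hO : (c κ) =O[atTop] fun _ : ℕ => (1 : ℝ) :=
      Asymptotics.IsBigO.of_bound B (Eventually.of_forall fun n => by simpa using hB n)
    simpa using hO.mul_isLittleO (isLittleO_term hlt (hS κ hκ) (hS κ₀ hκ₀) hT t)
  have hpos := hS κ₀ hκ₀
  filter_upwards [h.def hε] with n hn
  rwa [Real.norm_eq_abs, Real.norm_of_nonneg (by positivity)] at hn

/-! ### Correctness for a single residue class -/

section ResidueClass

variable {N : ℕ} {F : ExpPoly N} (D : Frequencies F) (t : ℕ)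

theorem exists_abs_coeffAt_le (X : Fin N → ℝ) (κ : ℝ × ℕ) :
    ∃ B, ∀ n, |coeffAt D t κ.1 κ.2 X n| ≤ B :=
  ⟨_, abs_coeffAt_le D t κ.1 κ.2 X⟩

/-- With `μ` the leading minimum and `g` the leading scale, the leading term is at least `μ * g`,
higher terms are nonnegative, and lower ones eventually total at most `μ / 2 * g` in absolute value.
-/
theorem eventually_evalAt_pos {X : Fin N → ℝ} {κ₀ : ℝ × ℕ} (hκ₀ : κ₀ ∈ terms F)
    (h : LeadingSystem D t κ₀ X) : ∀ᶠ n : ℕ in atTop, 0 < (evalAt X (D.T * n + t) F).re := by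
  classical
  obtain ⟨hpos, hnonneg⟩ := h
  change 0 < torusMin D t κ₀.1 κ₀.2 X at hpos
  have hr := term_fst_pos hκ₀
  filter_upwards [eventually_abs_sum_lower_le (fun κ hκ => term_fst_pos hκ) D.T_pos t
    (exists_abs_coeffAt_le D t X) hκ₀ (half_pos hpos), eventually_ge_atTop 1] with n hlow hn
  have hn' : (0 : ℝ) < n := by exact_mod_cast hn
  have hg : 0 < (n : ℝ) ^ κ₀.2 * κ₀.1 ^ (D.T * n + t) := by positivity
  rw [evalAt_re_eq_sum_terms, ← Finset.sum_filter_add_sum_filter_not _ (fun κ => TermLT κ κ₀)]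
  have hnot : ∀ κ ∈ (terms F).filter (fun κ => ¬ TermLT κ κ₀),
      0 ≤ coeffAt D t κ.1 κ.2 X n * ((n : ℝ) ^ κ.2 * κ.1 ^ (D.T * n + t)) := by
    intro κ hκ
    obtain ⟨hκ, hlt⟩ := Finset.mem_filter.1 hκ
    have hκr := term_fst_pos hκ
    refine mul_nonneg (le_trans ?_ (torusMin_le_coeffAt D t κ.1 κ.2 X n)) (by positivity)
    rw [termLT_iff_toLex_lt, not_lt] at hlt
    rcases hlt.eq_or_lt with heq | hlt
    · rw [← toLex_inj.1 heq]
      exact hpos.le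
    · exact hnonneg κ hκ (termLT_iff_toLex_lt.2 hlt)
  have hlead := Finset.single_le_sum hnot (Finset.mem_filter.2 ⟨hκ₀, by
    rw [termLT_iff_toLex_lt]; exact lt_irrefl _⟩)
  have hc := mul_le_mul_of_nonneg_right (torusMin_le_coeffAt D t κ₀.1 κ₀.2 X n) hg.le
  have := (abs_le.1 hlow).1
  nlinarith [mul_pos hpos hg]

theorem continuous_C2Torus (r : ℝ) (l : ℕ) (X : Fin N → ℝ) : Continuous (C2Torus D t r l X) := by
  unfold C2Torus
  refine Complex.continuous_re.comp ?_
  refine continuous_finsetSum _ fun η _ => continuous_const.mul ?_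
  refine continuous_finsetProd _ fun i _ => ?_
  exact (continuous_subtype_val.comp (continuous_apply i)).zpow₀ _
    fun y => Or.inl (Circle.coe_ne_zero _)

/-- The coefficient comes arbitrarily close to each of its values on the torus. -/
theorem frequently_abs_C2_sub_lt (r : ℝ) (l : ℕ) (X : Fin N → ℝ) (y : Fin (D.dim r) → Circle)
    {ε : ℝ} (hε : 0 < ε) :
    ∃ᶠ n : ℕ in atTop, |C2 D t r l X n - C2Torus D t r l X y| < ε := by
  have hopen : IsOpen {z | |C2Torus D t r l X z - C2Torus D t r l X y| < ε} :=
    isOpen_lt ((continuous_C2Torus D t r l X).sub continuous_const).abs continuous_const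
  refine (frequently_torusPoint_mem (D.indep r) D.T_pos t hopen ⟨y, by simpa using hε⟩).mono
    fun n hn => ?_
  rw [C2_eq_C2Torus]
  exact hn

/-- The minimum over the torus is the infimum along the residue class. -/
theorem frequently_coeffAt_lt (r : ℝ) (l : ℕ) (X : Fin N → ℝ) {ε : ℝ} (hε : 0 < ε) :
    ∃ᶠ n : ℕ in atTop, coeffAt D t r l X n < torusMin D t r l X + ε := by
  obtain ⟨y, hy⟩ := (isLeast_torusMin D t r l X).1
  refine (frequently_abs_C2_sub_lt D t r l X y hε).mono fun n hn => ?_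
  have := (abs_lt.1 hn).2
  rw [coeffAt, ← hy]
  linarith

/-- The coefficient is then constant in `n`, and by density its values approach the minimum. This
lets the Assumption turn a zero minimum into a zero coefficient. -/
theorem coeffAt_eq_torusMin {r : ℝ} {l : ℕ} {X : Fin N → ℝ} (h : ∀ n, C2 D t r l X n = 0) (n : ℕ) :
    coeffAt D t r l X n = torusMin D t r l X := by
  refine le_antisymm (le_of_forall_pos_le_add fun ε hε => ?_) (torusMin_le_coeffAt D t r l X n)
  obtain ⟨k, hk⟩ := (frequently_coeffAt_lt D t r l X hε).exists
  rw [coeffAt, h] at hk ⊢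
  exact hk.le

/-- The leading term is the largest one with nonzero torus minimum; all coefficients above it vanish
identically by `hass`. -/
theorem exists_leadingSystem {X : Fin N → ℝ}
    (hpos : ∀ n : ℕ, 0 < (evalAt X (D.T * n + t) F).re)
    (hass : ∀ κ ∈ terms F, (∃ n : ℕ, C2 D t κ.1 κ.2 X n ≠ 0) → torusMin D t κ.1 κ.2 X ≠ 0) :
    ∃ κ ∈ terms F, LeadingSystem D t κ X := by
  classical
  have hzero : ∀ κ ∈ terms F, torusMin D t κ.1 κ.2 X = 0 → ∀ n, coeffAt D t κ.1 κ.2 X n = 0 := by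
    intro κ hκ h0 n
    have hC2 : ∀ n, C2 D t κ.1 κ.2 X n = 0 := by
      by_contra! h
      exact hass κ hκ h h0
    rw [coeffAt_eq_torusMin D t hC2, h0]
  have hne : ((terms F).filter fun κ => torusMin D t κ.1 κ.2 X ≠ 0).Nonempty := by
    by_contra hempty
    rw [Finset.not_nonempty_iff_eq_empty, Finset.filter_eq_empty_iff] at hempty
    have := hpos 0
    rw [evalAt_re_eq_sum_terms, Finset.sum_eq_zero] at this
    · exact lt_irrefl _ this
    · intro κ hκ
      rw [hzero κ hκ (not_not.1 (hempty hκ)), zero_mul]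
  obtain ⟨κ₀, hκ₀, hmax⟩ := Finset.exists_max_image _ (fun κ : ℝ × ℕ => toLex κ) hne
  obtain ⟨hκ₀, hne₀⟩ := Finset.mem_filter.1 hκ₀
  have habove : ∀ κ ∈ terms F, TermLT κ₀ κ → torusMin D t κ.1 κ.2 X = 0 := by
    intro κ hκ hlt
    by_contra h
    exact (termLT_iff_toLex_lt.1 hlt).not_ge (hmax κ (Finset.mem_filter.2 ⟨hκ, h⟩))
  refine ⟨κ₀, hκ₀, ?_, fun κ hκ hlt => (habove κ hκ hlt).ge⟩
  by_contra hneg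
  have hneg : torusMin D t κ₀.1 κ₀.2 X < 0 := lt_of_le_of_ne (not_lt.1 hneg) hne₀
  set μ := torusMin D t κ₀.1 κ₀.2 X with hμ
  have hr := term_fst_pos hκ₀
  -- With `-μ / 2` for both tolerances, at some `n` the leading term is at most `μ / 2 * g` and the
  -- lower ones at most `-μ / 2 * g`, so the total is nonpositive.
  have hlow := eventually_abs_sum_lower_le (fun κ hκ => term_fst_pos hκ) D.T_pos t
    (exists_abs_coeffAt_le D t X) hκ₀ (ε := -μ / 2) (by linarith)
  obtain ⟨n, hn, hlow⟩ := ((frequently_coeffAt_lt D t κ₀.1 κ₀.2 X (ε := -μ / 2)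
    (by linarith)).and_eventually hlow).exists
  have hg : 0 ≤ (n : ℝ) ^ κ₀.2 * κ₀.1 ^ (D.T * n + t) := by positivity
  have hp := hpos n
  rw [evalAt_re_eq_sum_terms, ← Finset.sum_filter_add_sum_filter_not _ (fun κ => TermLT κ κ₀),
    Finset.sum_eq_single_of_mem (s := (terms F).filter fun κ => ¬ TermLT κ κ₀) κ₀] at hp
  · have h1 := (abs_le.1 hlow).2
    rw [← hμ] at hn
    have h2 := mul_le_mul_of_nonneg_right hn.le hg
    nlinarith
  · rw [Finset.mem_filter, termLT_iff_toLex_lt]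
    exact ⟨hκ₀, lt_irrefl _⟩
  · intro κ hκ hκne
    obtain ⟨hκ, hlt⟩ := Finset.mem_filter.1 hκ
    rw [termLT_iff_toLex_lt, not_lt] at hlt
    have hlt : TermLT κ₀ κ := termLT_iff_toLex_lt.2
      (lt_of_le_of_ne hlt fun h => hκne (toLex_inj.1 h).symm)
    rw [hzero κ hκ (habove κ hκ hlt), zero_mul]

end ResidueClass

/-! ### Correctness of the algorithm -/

section Correctness

variable {N m : ℕ} {A : Matrix (Fin N) (Fin N) ℚ} {P : Fin m → MvPolynomial (Fin N) ℚ}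

theorem evalAt_guardExpr (X : Fin N → ℝ) (n : ℕ) (i : Fin m) :
    evalAt X n (guardExpr A P i) =
      ((MvPolynomial.aeval ((step A)^[n + zeroMult A] X) (P i) : ℝ) : ℂ) := by
  have hgen : IsGeneralExpression A (generalExpression A) :=
    Classical.choose_spec (exists_isGeneralExpression A)
  have key : ∀ p : MvPolynomial (Fin N) ℚ,
      evalAt X n (MvPolynomial.aeval (generalExpression A) p) =
        ((MvPolynomial.aeval ((step A)^[n + zeroMult A] X) p : ℝ) : ℂ) := by
    intro p
    induction p using MvPolynomial.induction_on with
    | C a => simp [evalAt_single]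
    | add p q hp hq => simp [hp, hq]
    | mul_X p j hp => simp [hp, hgen X n j]
  exact key (P i)

theorem evalAt_guardExpr_re (X : Fin N → ℝ) (n : ℕ) (i : Fin m) :
    (evalAt X n (guardExpr A P i)).re =
      MvPolynomial.aeval ((step A)^[n + zeroMult A] X) (P i) := by
  rw [evalAt_guardExpr, Complex.ofReal_re]

/-- The guard may fail early on the orbit of `X`, so the nonterminating input is a late iterate of
`X`. -/
theorem not_terminating_of_guessSystem {D : ∀ i, Frequencies (guardExpr A P i)} {g : Guess D}
    {X : Fin N → ℝ} (h : GuessSystem D g X) : ¬ Terminating A P := by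
  have hall : ∀ᶠ n : ℕ in atTop, ∀ (i : Fin m) (t : Fin (D i).T),
      0 < (evalAt X ((D i).T * n + t) (guardExpr A P i)).re :=
    eventually_all.2 fun i => eventually_all.2 fun t =>
      eventually_evalAt_pos (D i) t (g i t).2 (h i t)
  obtain ⟨n₀, hn₀⟩ := eventually_atTop.1 hall
  -- Every `k ≥ K` has quotient `k / T_i ≥ n₀` for all `i` at once, because each `T_i` divides the
  -- product.
  let K := n₀ * ∏ i, (D i).T
  have hpos : ∀ k, K ≤ k → Guard P ((step A)^[k + zeroMult A] X) := by
    intro k hk i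
    have hT := (D i).T_pos
    have hq : n₀ ≤ k / (D i).T := by
      rw [Nat.le_div_iff_mul_le hT]
      refine le_trans (Nat.mul_le_mul_left _ ?_) hk
      exact Nat.le_of_dvd (Finset.prod_pos fun j _ => (D j).T_pos)
        (Finset.dvd_prod_of_mem (fun j => (D j).T) (Finset.mem_univ i))
    have := hn₀ _ hq i ⟨k % (D i).T, Nat.mod_lt _ hT⟩
    simp only [Nat.div_add_mod, evalAt_guardExpr_re] at this
    exact this
  intro hterm
  obtain ⟨n, hn⟩ := hterm ((step A)^[K + zeroMult A] X)
  refine hn ?_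
  rw [← Function.iterate_add_apply, ← add_assoc]
  exact hpos (n + K) (Nat.le_add_left _ _)

/-- A single nonterminating input `X` yields a leading term in every residue class of every guard,
and these terms form the guess that `X` solves. -/
theorem exists_guessSystem_of_not_terminating {D : ∀ i, Frequencies (guardExpr A P i)}
    (hD : MainAssumption D) (h : ¬ Terminating A P) :
    ∃ g : Guess D, ∃ X : Fin N → ℝ, GuessSystem D g X := by
  simp only [Terminating, TerminatesOn, not_forall, not_exists, not_not] at h
  obtain ⟨X, hX⟩ := h
  have key : ∀ (i : Fin m) (t : Fin (D i).T),
      ∃ κ ∈ terms (guardExpr A P i), LeadingSystem (D i) t κ X := fun i t =>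
    exists_leadingSystem (D i) t
      (fun n => by rw [evalAt_guardExpr_re]; exact hX _ i) (hD X i t)
  choose g hg hsys using key
  exact ⟨fun i t => ⟨g i t, hg i t⟩, X, hsys⟩

theorem termination_eq_nonterminating_iff (D : ∀ i, Frequencies (guardExpr A P i)) :
    termination D = Answer.nonterminating ↔
      ∃ g : Guess D, ∃ X : Fin N → ℝ, GuessSystem D g X := by
  unfold termination
  split_ifs with h <;> simp [h]

theorem termination_eq_terminating_iff (D : ∀ i, Frequencies (guardExpr A P i)) :
    termination D = Answer.terminating ↔
      ¬ ∃ g : Guess D, ∃ X : Fin N → ℝ, GuessSystem D g X := by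
  unfold termination
  split_ifs with h <;> simp [h]

end Correctness

end

end LinearLoop

theorem mainTheorem3 {N m : ℕ} (A : Matrix (Fin N) (Fin N) ℚ)
    (P : Fin m → MvPolynomial (Fin N) ℚ) :
    (∀ i, Nonempty (LinearLoop.Frequencies (LinearLoop.guardExpr A P i))) ∧
    ∀ D : ∀ i, LinearLoop.Frequencies (LinearLoop.guardExpr A P i),
      (LinearLoop.MainAssumption D →
        (LinearLoop.termination D = LinearLoop.Answer.terminating ↔
          LinearLoop.Terminating A P)) ∧
      (LinearLoop.termination D = LinearLoop.Answer.nonterminating →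
        ¬ LinearLoop.Terminating A P) := by
  refine ⟨fun i => LinearLoop.nonempty_frequencies _, fun D => ⟨fun hD => ?_, fun h => ?_⟩⟩
  · rw [LinearLoop.termination_eq_terminating_iff]
    constructor
    · intro h
      by_contra hterm
      exact h (LinearLoop.exists_guessSystem_of_not_terminating hD hterm)
    · rintro hterm ⟨g, X, h⟩
      exact LinearLoop.not_terminating_of_guessSystem h hterm
  · obtain ⟨g, X, h⟩ := (LinearLoop.termination_eq_nonterminating_iff D).1 h
    exact LinearLoop.not_terminating_of_guessSystem h
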